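/- Let $(M, ds^2_M)$ be a (smooth, finite-dimensional) Riemannian manifold without boundary, and let $I_0, I_1 : (0,\infty)\to(0,\infty)$ be smooth. Equip $\mathcal{M} = M\times(0,\infty)$ with the warped metric $$ds^2(x,\sigma) = I_0(\sigma)\,d\sigma^2 + I_1(\sigma)\,ds^2_M(x).$$ Let $r$ be a vertical arclength coordinate, that is, a function $r=r(\sigma)$ with $dr/d\sigma = I_0(\sigma)^{1/2}$, and write $\partial_r = I_0^{-1/2}\,\partial_\sigma$, both as a vector field on $\mathcal{M}$ and as a derivation acting on functions of $\sigma$. Let $K^{\mathcal{M}}$ and $K^M$ denote the sectional curvatures of $\mathcal{M}$ and $M$. Then, at every point $(x,\sigma)\in\mathcal{M}$, identifying $T_xM$ with the tangent space of the slice $M\times\{\sigma\}$: 1. (Gauss equation) for all linearly independent $u, v\in T_xM$, $$K^{\mathcal{M}}(u,v) = \frac{1}{I_1}\,K^M(u,v) - \frac14\left(\frac{\partial_r I_1}{I_1}\right)^2;$$ 2. (mixed curvature equation) for all $u\in T_xM$ with $u\neq 0$, $$K^{\mathcal{M}}(u,\partial_r) = -\,\frac{\partial_r^2\, I_1^{1/2}}{I_1^{1/2}};$$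 3. $\partial_r$ is a unit normal to the slice $M\times\{\sigma\}$, and the second fundamental form of the slice, $S(v) :=$ the component tangent to $M$ of the Levi-Civita covariant derivative $\nabla_v\partial_r$ in $\mathcal{M}$, is $$S(v) = \frac12\left(\frac{\partial_r I_1}{I_1}\right) v \qquad\text{for all } v\in T_xM.$$ -/

import Mathlib

open Set TopologicalSpace Bundle
open scoped Manifold ContDiff

noncomputable section

namespace WarpedMetrics

section Riemannian

variable {E : Type*} [NormedAddCommGroup E] [NormedSpace ℝ E]
  {H : Type*} [TopologicalSpace H] (I : ModelWithCorners ℝ E H)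
  {M : Type*} [TopologicalSpace M] [ChartedSpace H M]

/-- A field of bilinear forms on the tangent spaces of a manifold (covariant 2-tensor field). -/
abbrev FormField (M : Type*) [TopologicalSpace M] [ChartedSpace H M] :=
  ∀ x : M, TangentSpace I x →L[ℝ] TangentSpace I x →L[ℝ] ℝ

variable {I}

/-- The tensor field `g` read in the preferred chart `φ` around `p`: at the coordinate point `y`
this is the pull-back of `g` at `φ⁻¹ y` by the derivative of `φ⁻¹` at `y`. -/
def chartMetric (g : FormField I M) (p : M) (y : E) : E →L[ℝ] E →L[ℝ] ℝ :=
  let D : E →L[ℝ] E := mfderiv 𝓘(ℝ, E) I (extChartAt I p).symm y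
  let b : E →L[ℝ] E →L[ℝ] ℝ := g ((extChartAt I p).symm y)
  b.bilinearComp D D

/-- Christoffel symbols of the first kind in the preferred chart around `p`:
the covector `w ↦ ½ (∂ᵤ G(v, w) + ∂ᵥ G(u, w) - ∂_w G(u, v))`. -/
def christoffelFirst (g : FormField I M) (p : M) (y u v : E) : E →L[ℝ] ℝ :=
  (1 / 2 : ℝ) • (fderiv ℝ (chartMetric g p) y u v + fderiv ℝ (chartMetric g p) y v u
    - ((fderiv ℝ (chartMetric g p) y).flip u).flip v)

/-- Christoffel symbols (of the second kind) of the Levi-Civita connection of `g` in the preferred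
chart around `p`: the vector `Γ(u, v)` with `G(Γ(u, v), w) = christoffelFirst u v w`. -/
def christoffel (g : FormField I M) (p : M) (y u v : E) : E :=
  (chartMetric g p y).inverse (christoffelFirst g p y u v)

/-- The Levi-Civita covariant derivative `∇_v X` at `p` of a vector field `X` in the direction
of a tangent vector `v` at `p`, computed in the preferred chart around `p`. (The tangent space at
`p` is identified with `E` through this very chart.) -/
def covDeriv (g : FormField I M) (X : ∀ x : M, TangentSpace I x) (p : M)
    (v : TangentSpace I p) : TangentSpace I p :=
  let X' : E → E := VectorField.mpullback 𝓘(ℝ, E) I (extChartAt I p).symm X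
  let v' : E := v
  (fderiv ℝ X' (extChartAt I p p) v'
    + christoffel g p (extChartAt I p p) v' (X' (extChartAt I p p)) : E)

/-- The Riemann curvature `R(u, v) w = ∇_u ∇_v w - ∇_v ∇_u w - ∇_{[u, v]} w` at `p`, computed in the
preferred chart around `p` (`u`, `v`, `w` extended with constant coordinates). -/
def curvature (g : FormField I M) (p : M) (u v w : TangentSpace I p) : TangentSpace I p :=
  let y : E := extChartAt I p p
  let Γ : E → E → E → E := christoffel g p
  let u' : E := u
  let v' : E := v
  let w' : E := w
  (fderiv ℝ (fun z ↦ Γ z v' w') y u' - fderiv ℝ (fun z ↦ Γ z u' w') y v'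
    + Γ y u' (Γ y v' w') - Γ y v' (Γ y u' w') : E)

/-- The sectional curvature `K(u, v) = ⟨R(u, v) v, u⟩ / (⟨u, u⟩ ⟨v, v⟩ - ⟨u, v⟩²)` of `g` at `p`. -/
def sectionalCurvature (g : FormField I M) (p : M) (u v : TangentSpace I p) : ℝ :=
  g p (curvature g p u v v) u / (g p u u * g p v v - g p u v ^ 2)

end Riemannian

/-- The half-line `(0, ∞)`, as an open submanifold of `ℝ`. -/
abbrev PosLine : Opens ℝ := ⟨Ioi 0, isOpen_Ioi⟩

section Warped

variable {E : Type*} [NormedAddCommGroup E] [NormedSpace ℝ E]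
  {H : Type*} [TopologicalSpace H] {I : ModelWithCorners ℝ E H}
  {M : Type*} [TopologicalSpace M] [ChartedSpace H M]

/-- The warped metric `I₀(σ) dσ² + I₁(σ) g` on `M × (0, ∞)`. -/
def warpedMetric (g : FormField I M) (I₀ I₁ : ℝ → ℝ) :
    FormField (I.prod 𝓘(ℝ, ℝ)) (M × PosLine) := fun z ↦
  let b : E →L[ℝ] E →L[ℝ] ℝ := g z.1
  (I₀ z.2 • (ContinuousLinearMap.mul ℝ ℝ).bilinearComp
      (ContinuousLinearMap.snd ℝ E ℝ) (ContinuousLinearMap.snd ℝ E ℝ)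
    + I₁ z.2 • b.bilinearComp
      (ContinuousLinearMap.fst ℝ E ℝ) (ContinuousLinearMap.fst ℝ E ℝ) :
    (E × ℝ) →L[ℝ] (E × ℝ) →L[ℝ] ℝ)

/-- A vector tangent to `M` at `x`, as a tangent vector of the slice `M × {σ}` at `(x, σ)`: its
image under the derivative of the embedding `x ↦ (x, σ)`. -/
def sliceVector (x : M) (σ : PosLine) (u : TangentSpace I x) :
    TangentSpace (I.prod 𝓘(ℝ, ℝ)) ((x, σ) : M × PosLine) :=
  mfderiv I (I.prod 𝓘(ℝ, ℝ)) (fun x' : M ↦ ((x', σ) : M × PosLine)) x u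

/-- The derivative `∂_r f` of a function `f` of `σ` with respect to the coordinate `r = r(σ)`,
that is, `(df/dσ) / (dr/dσ)`. -/
def coordDeriv (r f : ℝ → ℝ) (σ : ℝ) : ℝ := deriv f σ / deriv r σ

/-- The coordinate vector field `∂_r = (dr/dσ)⁻¹ ∂_σ` on `M × (0, ∞)`. -/
def vertField (r : ℝ → ℝ) (z : M × PosLine) : TangentSpace (I.prod 𝓘(ℝ, ℝ)) z :=
  (((0 : E), (deriv r z.2)⁻¹) : E × ℝ)

/-- The second fundamental form (as an endomorphism) at `x` of the slice `M × {σ}` for the metric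
`G` on `M × (0, ∞)` and the normal field `N`: the component of `∇_v N` tangent to `M`. -/
def secondFundamentalForm (G : FormField (I.prod 𝓘(ℝ, ℝ)) (M × PosLine))
    (N : ∀ z : M × PosLine, TangentSpace (I.prod 𝓘(ℝ, ℝ)) z)
    (x : M) (σ : PosLine) (v : TangentSpace I x) : TangentSpace I x :=
  mfderiv (I.prod 𝓘(ℝ, ℝ)) I (Prod.fst : M × PosLine → M) (x, σ)
    (covDeriv G N (x, σ) (sliceVector x σ v))

end Warped

end WarpedMetrics

end

open WarpedMetrics

open Filter Topology

namespace WarpedMetrics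

/-! ### Christoffel symbols of a warped metric on a vector space. -/

section Flat

variable {E : Type*} [NormedAddCommGroup E] [NormedSpace ℝ E]

/-! Everything reduces to a computation in one chart. The chart of `M × PosLine` at `(x, σ)` is the
chart of `M` times the inclusion of the half-line, so there the metric reads `A(s) ds² + B(s) G(y)`
with `G` the chart expression of the metric of `M` (`chartMetric_warpedMetric`). The Koszul formula
gives (`flatChristoffel_warpField`) `Γ((u,a),(v,b)) = (Γ_G(u,v) + B'/(2B) (a v + b u), A'/(2A) a b -
B'/(2A) G(u,v))`.

All three claims follow. Both sectional curvatures pair `R(U,V)V` with a horizontal vector, so only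
its `E`-component matters. For horizontal `u, v` it is that of `G` plus the products of the two
mixed parts of `Γ`, namely `-B'²/(4AB) (G(v,v) u - G(u,v) v)`
(`fst_flatCurvature_warpField_horizontal`). For `u` and `b ∂_s` it is a multiple of `u` involving
the derivative of `B'/(2B)` (`fst_flatCurvature_warpField_mixed`), identified with `-∂_r²√B / √B`
when `b = A^{-1/2}` by `coordDeriv_coordDeriv_sqrt`. Finally `∂_r` has coordinates independent of
`y`, so `∇_v ∂_r` is just `Γ((v,0),(0,A^{-1/2}))`. -/

/-- Christoffel symbols of the first kind of a field of bilinear forms on a vector space. -/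
noncomputable def flatChristoffelFirst (G : E → E →L[ℝ] E →L[ℝ] ℝ) (y u v : E) : E →L[ℝ] ℝ :=
  (1 / 2 : ℝ) • (fderiv ℝ G y u v + fderiv ℝ G y v u - ((fderiv ℝ G y).flip u).flip v)

/-- Christoffel symbols of a field of bilinear forms on a vector space. -/
noncomputable def flatChristoffel (G : E → E →L[ℝ] E →L[ℝ] ℝ) (y u v : E) : E :=
  (G y).inverse (flatChristoffelFirst G y u v)

/-- Curvature of a field of bilinear forms on a vector space. -/
noncomputable def flatCurvature (G : E → E →L[ℝ] E →L[ℝ] ℝ) (y u v w : E) : E :=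
  fderiv ℝ (fun z ↦ flatChristoffel G z v w) y u - fderiv ℝ (fun z ↦ flatChristoffel G z u w) y v
    + flatChristoffel G y u (flatChristoffel G y v w)
    - flatChristoffel G y v (flatChristoffel G y u w)

/-- The bilinear form `a dσ² + b B` on `E × ℝ`. -/
noncomputable def warpForm (a b : ℝ) (B : E →L[ℝ] E →L[ℝ] ℝ) : (E × ℝ) →L[ℝ] (E × ℝ) →L[ℝ] ℝ :=
  a • (ContinuousLinearMap.mul ℝ ℝ).bilinearComp
      (ContinuousLinearMap.snd ℝ E ℝ) (ContinuousLinearMap.snd ℝ E ℝ)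
    + b • B.bilinearComp (ContinuousLinearMap.fst ℝ E ℝ) (ContinuousLinearMap.fst ℝ E ℝ)

@[simp]
theorem warpForm_apply (a b : ℝ) (B : E →L[ℝ] E →L[ℝ] ℝ) (u v : E × ℝ) :
    warpForm a b B u v = a * (u.2 * v.2) + b * B u.1 v.1 := by
  simp [warpForm]

/-- `B ↦ B ∘ (fst × fst)`, as a continuous linear map. -/
noncomputable def liftForm : (E →L[ℝ] E →L[ℝ] ℝ) →L[ℝ] (E × ℝ) →L[ℝ] (E × ℝ) →L[ℝ] ℝ :=
  (ContinuousLinearMap.precomp _ (ContinuousLinearMap.fst ℝ E ℝ)).comp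
    (ContinuousLinearMap.postcomp E (ContinuousLinearMap.precomp ℝ (ContinuousLinearMap.fst ℝ E ℝ)))

@[simp]
theorem liftForm_apply (B : E →L[ℝ] E →L[ℝ] ℝ) (u v : E × ℝ) :
    liftForm B u v = B u.1 v.1 := by
  simp [liftForm]

/-- Isolates a constant form and a continuous linear image of `B`, the shape to which
`fderiv_smul_add_smul` applies. -/
theorem warpForm_eq (a b : ℝ) (B : E →L[ℝ] E →L[ℝ] ℝ) :
    warpForm a b B = a • warpForm 1 0 (0 : E →L[ℝ] E →L[ℝ] ℝ) + b • liftForm B := by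
  ext <;> simp

/-- The warped field of forms `A(s) ds² + B(s) G(y)`. -/
noncomputable def warpField (A B : ℝ → ℝ) (G : E → E →L[ℝ] E →L[ℝ] ℝ) (z : E × ℝ) :
    (E × ℝ) →L[ℝ] (E × ℝ) →L[ℝ] ℝ :=
  warpForm (A z.2) (B z.2) (G z.1)

/-- Definiteness makes `v ↦ B v` injective, and `E` and its dual have the same finite dimension. -/
theorem isInvertible_of_pos [FiniteDimensional ℝ E] {B : E →L[ℝ] E →L[ℝ] ℝ}
    (hB : ∀ v ≠ 0, 0 < B v v) : B.IsInvertible := by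
  have hinj : Function.Injective (B : E →ₗ[ℝ] (E →L[ℝ] ℝ)) := by
    rw [← LinearMap.ker_eq_bot, LinearMap.ker_eq_bot']
    intro v hv
    by_contra h
    have h1 := hB v h
    have h2 : B v = 0 := hv
    simp [h2] at h1
  have hfr : Module.finrank ℝ E = Module.finrank ℝ (E →L[ℝ] ℝ) := by
    rw [← (LinearMap.toContinuousLinearMap (𝕜 := ℝ) (E := E) (F' := ℝ)).finrank_eq]
    exact (Subspace.dual_finrank_eq (K := ℝ) (V := E)).symm
  refine ⟨(LinearEquiv.ofInjectiveOfFinrankEq _ hinj hfr).toContinuousLinearEquiv, ?_⟩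
  ext v w
  rfl

theorem inverse_apply_eq_of_isInvertible {F F' : Type*} [NormedAddCommGroup F] [NormedSpace ℝ F]
    [NormedAddCommGroup F'] [NormedSpace ℝ F'] {B : F →L[ℝ] F'} (hB : B.IsInvertible)
    {x : F} {f : F'} (h : B x = f) : B.inverse f = x := by
  obtain ⟨e, rfl⟩ := hB
  subst h
  simp

theorem apply_inverse_of_isInvertible {F F' : Type*} [NormedAddCommGroup F] [NormedSpace ℝ F]
    [NormedAddCommGroup F'] [NormedSpace ℝ F'] {B : F →L[ℝ] F'} (hB : B.IsInvertible)
    (f : F') : B (B.inverse f) = f := by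
  obtain ⟨e, rfl⟩ := hB
  simp

theorem apply_flatChristoffel {G : E → E →L[ℝ] E →L[ℝ] ℝ} {y : E} (h : (G y).IsInvertible)
    (u v w : E) :
    G y (flatChristoffel G y u v) w =
      1 / 2 * (fderiv ℝ G y u v w + fderiv ℝ G y v u w - fderiv ℝ G y w u v) := by
  rw [flatChristoffel, apply_inverse_of_isInvertible h]
  simp [flatChristoffelFirst]

/-- No nondegeneracy is needed: `inverse` is a linear map even at its default value. -/
theorem flatChristoffel_zero_left (G : E → E →L[ℝ] E →L[ℝ] ℝ) (y v : E) :
    flatChristoffel G y 0 v = 0 := by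
  have h : flatChristoffelFirst G y 0 v = 0 := by
    refine ContinuousLinearMap.ext fun w ↦ ?_
    rw [flatChristoffelFirst, (fderiv ℝ G y).map_zero, ((fderiv ℝ G y).flip).map_zero]
    simp
  rw [flatChristoffel, h, ContinuousLinearMap.map_zero]

theorem flatChristoffel_zero_right (G : E → E →L[ℝ] E →L[ℝ] ℝ) (y u : E) :
    flatChristoffel G y u 0 = 0 := by
  have h : flatChristoffelFirst G y u 0 = 0 := by
    refine ContinuousLinearMap.ext fun w ↦ ?_
    rw [flatChristoffelFirst, (fderiv ℝ G y).map_zero, ContinuousLinearMap.map_zero,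
      ContinuousLinearMap.map_zero]
    simp
  rw [flatChristoffel, h, ContinuousLinearMap.map_zero]

theorem warpForm_pos {a b : ℝ} (ha : 0 < a) (hb : 0 < b) {B : E →L[ℝ] E →L[ℝ] ℝ}
    (hB : ∀ v ≠ 0, 0 < B v v) (v : E × ℝ) (hv : v ≠ 0) : 0 < warpForm a b B v v := by
  rw [warpForm_apply]
  by_cases h : v.1 = 0
  · have h2 : v.2 ≠ 0 := fun h2 ↦ hv (Prod.ext h h2)
    have : 0 < v.2 * v.2 := mul_self_pos.2 h2
    simp only [h, map_zero, mul_zero, add_zero]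
    positivity
  · exact add_pos_of_nonneg_of_pos (mul_nonneg ha.le (mul_self_nonneg _)) (mul_pos hb (hB _ h))

theorem fderiv_smul_add_smul {F F' : Type*} [NormedAddCommGroup F] [NormedSpace ℝ F]
    [NormedAddCommGroup F'] [NormedSpace ℝ F'] (c : F') (L : F →L[ℝ] F') {A B : ℝ → ℝ}
    {A' B' : ℝ} {f : E → F} {z : E × ℝ} (hA : HasDerivAt A A' z.2) (hB : HasDerivAt B B' z.2)
    (hf : DifferentiableAt ℝ f z.1)
    (u : E × ℝ) : fderiv ℝ (fun z : E × ℝ ↦ A z.2 • c + B z.2 • L (f z.1)) z u =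
      (u.2 * A') • c + (u.2 * B') • L (f z.1) + B z.2 • L (fderiv ℝ f z.1 u.1) := by
  have h1 : HasFDerivAt (fun z : E × ℝ ↦ A z.2) _ z :=
    hA.hasFDerivAt.comp z (hasFDerivAt_snd (𝕜 := ℝ) (E := E) (F := ℝ))
  have h2 : HasFDerivAt (fun z : E × ℝ ↦ B z.2) _ z :=
    hB.hasFDerivAt.comp z (hasFDerivAt_snd (𝕜 := ℝ) (E := E) (F := ℝ))
  have h4 : HasFDerivAt (fun z : E × ℝ ↦ L (f z.1))
      (L.comp ((fderiv ℝ f z.1).comp (ContinuousLinearMap.fst ℝ E ℝ))) z :=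
    L.hasFDerivAt.comp z (HasFDerivAt.comp (f := Prod.fst) z hf.hasFDerivAt hasFDerivAt_fst)
  have h5 : HasFDerivAt (fun z : E × ℝ ↦ A z.2 • c + B z.2 • L (f z.1)) _ z :=
    (h1.smul_const c).add (h2.smul h4)
  rw [h5.fderiv]
  simp
  abel

set_option synthInstance.maxHeartbeats 200000 in
theorem fderiv_warpField {A B : ℝ → ℝ} {A' B' : ℝ} {G : E → E →L[ℝ] E →L[ℝ] ℝ} {z : E × ℝ}
    (hA : HasDerivAt A A' z.2) (hB : HasDerivAt B B' z.2) (hG : DifferentiableAt ℝ G z.1)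
    (u v w : E × ℝ) :
    fderiv ℝ (warpField A B G) z u v w =
      u.2 * A' * (v.2 * w.2) + u.2 * B' * G z.1 v.1 w.1
        + B z.2 * fderiv ℝ G z.1 u.1 v.1 w.1 := by
  have h6 : warpField A B G = fun z : E × ℝ ↦ A z.2 • warpForm 1 0 (0 : E →L[ℝ] E →L[ℝ] ℝ) +
      B z.2 • liftForm (G z.1) := by
    funext z
    exact warpForm_eq _ _ _
  have h7 := fderiv_smul_add_smul (F := E →L[ℝ] E →L[ℝ] ℝ)
    (F' := (E × ℝ) →L[ℝ] (E × ℝ) →L[ℝ] ℝ) (warpForm 1 0 (0 : E →L[ℝ] E →L[ℝ] ℝ))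
    (liftForm (E := E)) hA hB hG u
  rw [h6, h7]
  simp

/-- The warped form is positive definite, hence invertible, so it suffices to pair the claimed
vector with every `w` and compare with the Koszul formula. -/
theorem flatChristoffel_warpField [FiniteDimensional ℝ E] {A B : ℝ → ℝ} {A' B' : ℝ}
    {G : E → E →L[ℝ] E →L[ℝ] ℝ} {z : E × ℝ}
    (hA : HasDerivAt A A' z.2) (hB : HasDerivAt B B' z.2) (hG : DifferentiableAt ℝ G z.1)
    (hA0 : 0 < A z.2) (hB0 : 0 < B z.2) (hpos : ∀ v ≠ 0, 0 < G z.1 v v) (u v : E × ℝ) :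
    flatChristoffel (warpField A B G) z u v =
      (flatChristoffel G z.1 u.1 v.1 + (B' / (2 * B z.2)) • (u.2 • v.1 + v.2 • u.1),
        A' / (2 * A z.2) * (u.2 * v.2) - B' / (2 * A z.2) * G z.1 u.1 v.1) := by
  refine inverse_apply_eq_of_isInvertible (isInvertible_of_pos (warpForm_pos hA0 hB0 hpos)) ?_
  refine ContinuousLinearMap.ext fun w ↦ ?_
  have h := apply_flatChristoffel (isInvertible_of_pos hpos) u.1 v.1 w.1
  simp only [warpForm_apply, map_add, map_smul, add_apply, smul_apply, h, flatChristoffelFirst,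
    sub_apply, ContinuousLinearMap.flip_apply, smul_eq_mul, fderiv_warpField hA hB hG]
  field_simp
  ring

end Flat

/-! ### Curvature of a warped metric on a vector space. -/

section FlatCurvature

variable {E : Type*} [NormedAddCommGroup E] [NormedSpace ℝ E] [FiniteDimensional ℝ E]
  {A B A' B' : ℝ → ℝ} {G : E → E →L[ℝ] E →L[ℝ] ℝ} {y : E} {s : ℝ}

/-- Curvature differentiates `Γ`, so the formula is needed on a neighbourhood and not only at the
point. -/
theorem eventually_flatChristoffel_warpField
    (hA : ∀ᶠ t in 𝓝 s, HasDerivAt A (A' t) t ∧ 0 < A t)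
    (hB : ∀ᶠ t in 𝓝 s, HasDerivAt B (B' t) t ∧ 0 < B t)
    (hG : ∀ᶠ z in 𝓝 y, DifferentiableAt ℝ G z ∧ ∀ v ≠ 0, 0 < G z v v) :
    ∀ᶠ z in 𝓝 (y, s), ∀ u v, flatChristoffel (warpField A B G) z u v =
      (flatChristoffel G z.1 u.1 v.1 + (B' z.2 / (2 * B z.2)) • (u.2 • v.1 + v.2 • u.1),
        A' z.2 / (2 * A z.2) * (u.2 * v.2) - B' z.2 / (2 * A z.2) * G z.1 u.1 v.1) := by
  have h1 : Tendsto Prod.fst (𝓝 (y, s)) (𝓝 y) := continuousAt_fst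
  have h2 : Tendsto Prod.snd (𝓝 (y, s)) (𝓝 s) := continuousAt_snd
  filter_upwards [h1.eventually hG, h2.eventually hA, h2.eventually hB] with z hG hA hB u v
  exact flatChristoffel_warpField hA.1 hB.1 hG.1 hA.2 hB.2 hG.2 u v

-- Covers every Christoffel field differentiated below. The second component does not enter the
-- result, but must be differentiable for the derivative of the pair not to be the default `0`.
omit [FiniteDimensional ℝ E] in
theorem fderiv_fst_add_smul_prod {f : E → E} {c k : ℝ → ℝ} {g : E → ℝ} {e : E} {c' : ℝ}
    (hf : DifferentiableAt ℝ f y) (hc : HasDerivAt c c' s) (hk : DifferentiableAt ℝ k s)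
    (hg : DifferentiableAt ℝ g y) (w : E × ℝ) :
    (fderiv ℝ (fun z : E × ℝ ↦ (f z.1 + c z.2 • e, k z.2 * g z.1)) (y, s) w).1 =
      fderiv ℝ f y w.1 + (w.2 * c') • e := by
  have hf' : HasFDerivAt (fun z : E × ℝ ↦ f z.1) _ (y, s) :=
    HasFDerivAt.comp (f := Prod.fst) (y, s) hf.hasFDerivAt hasFDerivAt_fst
  have hc' : HasFDerivAt (fun z : E × ℝ ↦ c z.2) _ (y, s) :=
    HasFDerivAt.comp (f := Prod.snd) (y, s) hc.hasFDerivAt hasFDerivAt_snd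
  have hg' : DifferentiableAt ℝ (fun z : E × ℝ ↦ k z.2 * g z.1) (y, s) :=
    (hk.comp (f := Prod.snd) (y, s) differentiableAt_snd).mul
      (hg.comp (f := Prod.fst) (y, s) differentiableAt_fst)
  have h : HasFDerivAt (fun z : E × ℝ ↦ (f z.1 + c z.2 • e, k z.2 * g z.1)) _ (y, s) :=
    (hf'.add (hc'.smul_const e)).prodMk hg'.hasFDerivAt
  rw [h.fderiv]
  simp

-- The `E`-component of `Γ` on horizontal vectors does not depend on `s`, so the derivative terms
-- are those of `G`. The correction arises in `Γ(u, Γ(v,v)) - Γ(v, Γ(u,v))`, where the vertical part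
-- of the inner symbol is fed back through the mixed part of the outer one.
set_option synthInstance.maxHeartbeats 200000 in
theorem fst_flatCurvature_warpField_horizontal
    (hA : ∀ᶠ t in 𝓝 s, HasDerivAt A (A' t) t ∧ 0 < A t)
    (hB : ∀ᶠ t in 𝓝 s, HasDerivAt B (B' t) t ∧ 0 < B t)
    (hG : ∀ᶠ z in 𝓝 y, DifferentiableAt ℝ G z ∧ ∀ v ≠ 0, 0 < G z v v)
    (hB' : DifferentiableAt ℝ B' s)
    (hΓ : ∀ u v, DifferentiableAt ℝ (fun z ↦ flatChristoffel G z u v) y) (u v : E) :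
    (flatCurvature (warpField A B G) (y, s) (u, 0) (v, 0) (v, 0)).1 =
      flatCurvature G y u v v - (B' s ^ 2 / (4 * A s * B s)) • (G y v v • u - G y u v • v) := by
  have hev := eventually_flatChristoffel_warpField hA hB hG
  have hA0 : 0 < A s := hA.self_of_nhds.2
  have hB0 : 0 < B s := hB.self_of_nhds.2
  have hd (u v w : E) :
      (fderiv ℝ (fun z ↦ flatChristoffel (warpField A B G) z (u, 0) (v, 0)) (y, s) (w, 0)).1 =
        fderiv ℝ (fun z ↦ flatChristoffel G z u v) y w := by
    have h1 : (fun z ↦ flatChristoffel (warpField A B G) z (u, 0) (v, 0)) =ᶠ[𝓝 (y, s)]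
        fun z ↦ (flatChristoffel G z.1 u v + (0 : ℝ) • u, -(B' z.2 / (2 * A z.2)) * G z.1 u v) := by
      filter_upwards [hev] with z hz
      rw [hz]
      simp
    have hk : DifferentiableAt ℝ (fun t ↦ -(B' t / (2 * A t))) s :=
      (hB'.div (hA.self_of_nhds.1.differentiableAt.const_mul 2) (by positivity)).neg
    have hg : DifferentiableAt ℝ (fun z ↦ G z u v) y :=
      (hG.self_of_nhds.1.clm_apply (differentiableAt_const u)).clm_apply (differentiableAt_const v)
    rw [h1.fderiv_eq, fderiv_fst_add_smul_prod (c := fun _ ↦ 0) (hΓ u v)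
      (hasDerivAt_const _ _) hk hg]
    simp
  have he := hev.self_of_nhds
  simp only [flatCurvature, Prod.fst_add, Prod.fst_sub, hd, he]
  simp only [zero_smul, smul_zero, add_zero, zero_add, mul_zero, zero_sub]
  match_scalars <;> field_simp
  all_goals ring

-- The three terms come from `Γ(u, Γ(∂_s,∂_s))`, `-∂_s Γ(u,∂_s)` and `-Γ(∂_s, Γ(u,∂_s))`;
-- `Γ(∂_s,∂_s)` is constant along `u`.
set_option synthInstance.maxHeartbeats 200000 in
theorem fst_flatCurvature_warpField_mixed {c : ℝ}
    (hA : ∀ᶠ t in 𝓝 s, HasDerivAt A (A' t) t ∧ 0 < A t)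
    (hB : ∀ᶠ t in 𝓝 s, HasDerivAt B (B' t) t ∧ 0 < B t)
    (hG : ∀ᶠ z in 𝓝 y, DifferentiableAt ℝ G z ∧ ∀ v ≠ 0, 0 < G z v v)
    (hA' : DifferentiableAt ℝ A' s) (hc : HasDerivAt (fun t ↦ B' t / (2 * B t)) c s) (u : E) (b : ℝ) :
    (flatCurvature (warpField A B G) (y, s) (u, 0) (0, b) (0, b)).1 =
      (b ^ 2 * (B' s / (2 * B s) * (A' s / (2 * A s)) - c - (B' s / (2 * B s)) ^ 2)) • u := by
  have hev := eventually_flatChristoffel_warpField hA hB hG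
  have hA0 : 0 < A s := hA.self_of_nhds.2
  have h1 : (fun z ↦ flatChristoffel (warpField A B G) z (0, b) (0, b)) =ᶠ[𝓝 (y, s)]
      fun z ↦ ((0 : E) + (0 : ℝ) • (0 : E), A' z.2 / (2 * A z.2) * (b * b)) := by
    filter_upwards [hev] with z hz
    rw [hz]
    simp [flatChristoffel_zero_right]
  have h2 : (fun z ↦ flatChristoffel (warpField A B G) z (u, 0) (0, b)) =ᶠ[𝓝 (y, s)]
      fun z ↦ ((0 : E) + (B' z.2 / (2 * B z.2)) • b • u, 0 * 0) := by
    filter_upwards [hev] with z hz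
    rw [hz]
    simp [flatChristoffel_zero_right]
  have hk : DifferentiableAt ℝ (fun t ↦ A' t / (2 * A t)) s :=
    hA'.div (hA.self_of_nhds.1.differentiableAt.const_mul 2) (by positivity)
  have hd1 : (fderiv ℝ (fun z ↦ flatChristoffel (warpField A B G) z (0, b) (0, b)) (y, s)
      (u, 0)).1 = 0 := by
    rw [h1.fderiv_eq, fderiv_fst_add_smul_prod (f := fun _ ↦ 0) (c := fun _ ↦ 0)
      (g := fun _ ↦ b * b) (differentiableAt_const _) (hasDerivAt_const _ _) hk
      (differentiableAt_const _)]
    simp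
  have hd2 : (fderiv ℝ (fun z ↦ flatChristoffel (warpField A B G) z (u, 0) (0, b)) (y, s)
      (0, b)).1 = (b * c) • b • u := by
    rw [h2.fderiv_eq, fderiv_fst_add_smul_prod (f := fun _ ↦ 0) (k := fun _ ↦ 0)
      (g := fun _ ↦ 0) (differentiableAt_const _) hc (differentiableAt_const _)
      (differentiableAt_const _)]
    simp
  have he := hev.self_of_nhds
  simp only [flatCurvature, Prod.fst_add, Prod.fst_sub, hd1, hd2, he, flatChristoffel_zero_left,
    flatChristoffel_zero_right]
  simp only [smul_zero, add_zero, zero_add, map_zero, mul_zero, zero_mul, sub_zero,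
    flatChristoffel_zero_right]
  module

end FlatCurvature

/-! ### Differentiability of Christoffel symbols. -/

section Smoothness

variable {E : Type*} [NormedAddCommGroup E] [NormedSpace ℝ E]

theorem differentiableAt_inverse_apply {F F' : Type*} [NormedAddCommGroup F] [NormedSpace ℝ F]
    [CompleteSpace F] [NormedAddCommGroup F'] [NormedSpace ℝ F'] {f : E → F →L[ℝ] F'} {g : E → F'}
    {y : E} (hf : DifferentiableAt ℝ f y) (hi : (f y).IsInvertible) (hg : DifferentiableAt ℝ g y) :
    DifferentiableAt ℝ (fun z ↦ (f z).inverse (g z)) y :=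
  (((hi.contDiffAt_map_inverse (n := 1)).differentiableAt one_ne_zero).comp y hf).clm_apply hg

theorem differentiableAt_apply_const {F W : Type*} [NormedAddCommGroup F] [NormedSpace ℝ F]
    [NormedAddCommGroup W] [NormedSpace ℝ W] {f : E → F →L[ℝ] W} {y : E}
    (hf : DifferentiableAt ℝ f y) (u : F) : DifferentiableAt ℝ (fun z ↦ f z u) y :=
  hf.clm_apply (differentiableAt_const u)

theorem differentiableAt_clm_comp {F W : Type*} [NormedAddCommGroup F] [NormedSpace ℝ F]
    [NormedAddCommGroup W] [NormedSpace ℝ W] (L : F →L[ℝ] W) {f : E → F} {y : E}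
    (hf : DifferentiableAt ℝ f y) : DifferentiableAt ℝ (fun z ↦ L (f z)) y :=
  L.differentiableAt.comp y hf

set_option synthInstance.maxHeartbeats 200000 in
theorem differentiableAt_flip_apply {F W : Type*} [NormedAddCommGroup F] [NormedSpace ℝ F]
    [NormedAddCommGroup W] [NormedSpace ℝ W] {f : E → F →L[ℝ] F →L[ℝ] W} {y : E}
    (hf : DifferentiableAt ℝ f y) (u : F) : DifferentiableAt ℝ (fun z ↦ (f z).flip u) y :=
  differentiableAt_apply_const (W := F →L[ℝ] W) (differentiableAt_clm_comp (F := F →L[ℝ] F →L[ℝ] W)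
    (W := F →L[ℝ] F →L[ℝ] W)
    (ContinuousLinearMap.flipₗᵢ ℝ F F W).toContinuousLinearEquiv.toContinuousLinearMap hf) u

theorem differentiableAt_fderiv {F : Type*} [NormedAddCommGroup F] [NormedSpace ℝ F]
    {f : E → F} {y : E} (hf : ContDiffAt ℝ 2 f y) : DifferentiableAt ℝ (fderiv ℝ f) y :=
  (hf.fderiv_right (m := 1) le_rfl).differentiableAt one_ne_zero

set_option synthInstance.maxHeartbeats 200000 in
theorem differentiableAt_flatChristoffel [CompleteSpace E] {G : E → E →L[ℝ] E →L[ℝ] ℝ} {y : E}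
    (hG : ContDiffAt ℝ 2 G y) (hi : (G y).IsInvertible) (u v : E) :
    DifferentiableAt ℝ (fun z ↦ flatChristoffel G z u v) y := by
  refine differentiableAt_inverse_apply (hG.differentiableAt two_ne_zero) hi ?_
  have hD := differentiableAt_fderiv (F := E →L[ℝ] E →L[ℝ] ℝ) hG
  have h1 (u v : E) : DifferentiableAt ℝ (fun z ↦ fderiv ℝ G z u v) y :=
    differentiableAt_apply_const (differentiableAt_apply_const hD u) v
  have h2 := differentiableAt_flip_apply (W := ℝ)
    (differentiableAt_flip_apply (W := E →L[ℝ] ℝ) hD u) v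
  exact (((h1 u v).add (h1 v u)).sub h2).const_smul (1 / 2 : ℝ)

end Smoothness

/-! ### The metric of `M` in a preferred chart. -/

section Chart

variable {E : Type*} [NormedAddCommGroup E] [NormedSpace ℝ E]
  {H : Type*} [TopologicalSpace H] {I : ModelWithCorners ℝ E H} [I.Boundaryless]
  {M : Type*} [TopologicalSpace M] [ChartedSpace H M] [IsManifold I ∞ M]

omit [IsManifold I ∞ M] in
theorem isInvertible_mfderiv_extChartAt_symm [IsManifold I 1 M] {p : M} {y : E}
    (hy : y ∈ (extChartAt I p).target) :
    (mfderiv 𝓘(ℝ, E) I (extChartAt I p).symm y).IsInvertible := by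
  have h := isInvertible_mfderivWithin_extChartAt_symm (I := I) hy
  rwa [I.range_eq_univ, mfderivWithin_univ] at h

omit [IsManifold I ∞ M] in
theorem mfderiv_extChartAt_symm_self [IsManifold I 1 M] (p : M) :
    mfderiv 𝓘(ℝ, E) I (extChartAt I p).symm (extChartAt I p p) =
      ContinuousLinearMap.id ℝ (TangentSpace I p) := by
  have h := mfderivWithin_range_extChartAt_symm (I := I) (x := p)
  rwa [I.range_eq_univ, mfderivWithin_univ] at h

omit [I.Boundaryless] [IsManifold I ∞ M] in
theorem chartMetric_apply (g : FormField I M) (p : M) (y u v : E) :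
    chartMetric g p y u v = g ((extChartAt I p).symm y)
      (mfderiv 𝓘(ℝ, E) I (extChartAt I p).symm y u)
      (mfderiv 𝓘(ℝ, E) I (extChartAt I p).symm y v) := rfl

omit [IsManifold I ∞ M] in
theorem chartMetric_self [IsManifold I 1 M] (g : FormField I M) (p : M) (u v : TangentSpace I p) :
    chartMetric g p (extChartAt I p p) u v = g p u v := by
  -- The base points agree only propositionally while the form's type depends on them, so both forms
  -- are first read on `E`.
  have hg (q : M) (h : q = p) (a b : E) :
      (g q : E →L[ℝ] E →L[ℝ] ℝ) a b = (g p : E →L[ℝ] E →L[ℝ] ℝ) a b := by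
    subst h
    rfl
  have hD (w : E) : (mfderiv 𝓘(ℝ, E) I (extChartAt I p).symm (extChartAt I p p) w : E) = w :=
    congrArg (fun L : E →L[ℝ] E ↦ L w) (mfderiv_extChartAt_symm_self p)
  exact (hg _ (extChartAt_to_inv p) _ _).trans
    (congrArg₂ (fun a b : E ↦ (g p : E →L[ℝ] E →L[ℝ] ℝ) a b) (hD u) (hD v))

theorem chartMetric_pos (g : ContMDiffRiemannianMetric I ∞ E (fun x : M ↦ TangentSpace I x))
    {p : M} {y : E} (hy : y ∈ (extChartAt I p).target) (v : E) (hv : v ≠ 0) :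
    0 < chartMetric g.inner p y v v := by
  refine g.pos _ _ fun h ↦ hv ?_
  exact (isInvertible_mfderiv_extChartAt_symm hy).injective (h.trans (map_zero _).symm)

/-- In finite dimension it is enough to treat `y ↦ G(y)(u, v)` for fixed `u, v`. This is the smooth
section `g` paired with the images of constant fields under the tangent map of the inverse chart.
Order 2 suffices: one derivative for `Γ`, one for the curvature. -/
theorem contDiffAt_chartMetric [FiniteDimensional ℝ E]
    (g : ContMDiffRiemannianMetric I ∞ E (fun x : M ↦ TangentSpace I x))
    {p : M} {y : E} (hy : y ∈ (extChartAt I p).target) :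
    ContDiffAt ℝ 2 (chartMetric g.inner p) y := by
  have hopen : IsOpen (extChartAt I p).target := isOpen_extChartAt_target p
  suffices h : ContDiffOn ℝ 2 (chartMetric g.inner p) (extChartAt I p).target from
    h.contDiffAt (hopen.mem_nhds hy)
  refine contDiffOn_clm_apply.2 fun u ↦ contDiffOn_clm_apply.2 fun v ↦ ?_
  have hs : ContMDiffOn 𝓘(ℝ, E) I ∞ (extChartAt I p).symm (extChartAt I p).target :=
    contMDiffOn_extChartAt_symm p
  have ht := hs.contMDiffOn_tangentMapWithin (m := 2) (by norm_cast) hopen.uniqueMDiffOn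
  have hvec (w : E) : ContMDiffOn 𝓘(ℝ, E) I.tangent 2
      (fun z ↦ TotalSpace.mk' E (E := fun x : M ↦ TangentSpace I x) ((extChartAt I p).symm z)
        (mfderiv 𝓘(ℝ, E) I (extChartAt I p).symm z w)) (extChartAt I p).target := by
    have hw : ContMDiffOn 𝓘(ℝ, E) 𝓘(ℝ, E).tangent 2
        (fun z : E ↦ (⟨z, w⟩ : TangentBundle 𝓘(ℝ, E) E)) (extChartAt I p).target :=
      contMDiffOn_vectorSpace_iff_contDiffOn (V := fun _ : E ↦ w).2 contDiffOn_const
    refine (ht.comp hw fun z hz ↦ hz).congr fun z hz ↦ ?_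
    simp only [Function.comp_apply, tangentMapWithin, mfderivWithin_of_isOpen hopen hz]
  have hg : ContMDiffOn 𝓘(ℝ, E) (I.prod 𝓘(ℝ, E →L[ℝ] E →L[ℝ] ℝ)) 2
      (fun z ↦ TotalSpace.mk' (E →L[ℝ] E →L[ℝ] ℝ)
        (E := fun x : M ↦ TangentSpace I x →L[ℝ] TangentSpace I x →L[ℝ] ℝ)
        ((extChartAt I p).symm z) (g.inner ((extChartAt I p).symm z))) (extChartAt I p).target :=
    (g.contMDiff.of_le (by norm_cast)).comp_contMDiffOn (hs.of_le (by norm_cast))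
  have h := hg.clm_bundle_apply₂ (F₃ := ℝ) (E₃ := Bundle.Trivial M ℝ) (hvec u) (hvec v)
  intro z hz
  have hz' := h z hz
  simp only [contMDiffWithinAt_totalSpace] at hz'
  exact hz'.2.contDiffWithinAt

end Chart

/-! ### Charts of the half-line. -/

section Line

theorem mem_extChartAt_posLine_target (σ : PosLine) {t : ℝ} (ht : 0 < t) :
    t ∈ (extChartAt 𝓘(ℝ, ℝ) σ).target :=
  (extChartAt 𝓘(ℝ, ℝ) σ).map_source (x := (⟨t, ht⟩ : PosLine))
    (by simp [extChartAt, TopologicalSpace.Opens.chartAt_eq]; trivial)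

theorem extChartAt_posLine_symm (σ : PosLine) {t : ℝ} (ht : 0 < t) :
    (extChartAt 𝓘(ℝ, ℝ) σ).symm t = ⟨t, ht⟩ :=
  (extChartAt 𝓘(ℝ, ℝ) σ).left_inv (x := (⟨t, ht⟩ : PosLine))
    (by simp [extChartAt, TopologicalSpace.Opens.chartAt_eq]; trivial)

/-- Every preferred chart of `PosLine` is the inclusion into `ℝ`, so the chart at `σ` may be
replaced by the one centred at `t`. -/
theorem mfderiv_extChartAt_posLine_symm (σ : PosLine) {t : ℝ} (ht : 0 < t) :
    mfderiv 𝓘(ℝ, ℝ) 𝓘(ℝ, ℝ) (extChartAt 𝓘(ℝ, ℝ) σ).symm t = ContinuousLinearMap.id ℝ ℝ :=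
  mfderiv_extChartAt_symm_self (⟨t, ht⟩ : PosLine)

end Line

/-! ### The warped metric and `∂_r` in the product chart. -/

section Product

variable {E : Type*} [NormedAddCommGroup E] [NormedSpace ℝ E]
  {H : Type*} [TopologicalSpace H] {I : ModelWithCorners ℝ E H} [I.Boundaryless]
  {M : Type*} [TopologicalSpace M] [ChartedSpace H M] [IsManifold I 1 M]

omit [I.Boundaryless] [IsManifold I 1 M] in
theorem extChartAt_prod_posLine_symm (x : M) (σ : PosLine) :
    ((extChartAt (I.prod 𝓘(ℝ, ℝ)) (x, σ)).symm : E × ℝ → M × PosLine) =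
      Prod.map (extChartAt I x).symm (extChartAt 𝓘(ℝ, ℝ) σ).symm := by
  rw [extChartAt_prod]
  rfl

theorem hasMFDerivAt_extChartAt_symm {p : M} {y : E} (hy : y ∈ (extChartAt I p).target) :
    HasMFDerivAt 𝓘(ℝ, E) I (extChartAt I p).symm y
      (mfderiv 𝓘(ℝ, E) I (extChartAt I p).symm y) := by
  have h := mdifferentiableWithinAt_extChartAt_symm (I := I) hy
  rw [I.range_eq_univ, mdifferentiableWithinAt_univ] at h
  exact h.hasMFDerivAt

theorem mfderiv_extChartAt_prod_posLine_symm (x : M) (σ : PosLine) {y : E} {t : ℝ}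
    (hy : y ∈ (extChartAt I x).target) (ht : 0 < t) (u : E × ℝ) :
    (mfderiv 𝓘(ℝ, E × ℝ) (I.prod 𝓘(ℝ, ℝ)) (extChartAt (I.prod 𝓘(ℝ, ℝ)) (x, σ)).symm (y, t) u :
      E × ℝ) = ((mfderiv 𝓘(ℝ, E) I (extChartAt I x).symm y u.1 : E), u.2) := by
  have h1 := (hasMFDerivAt_extChartAt_symm hy).mdifferentiableAt
  have h2 := (hasMFDerivAt_extChartAt_symm (mem_extChartAt_posLine_target σ ht)).mdifferentiableAt
  have h := mfderiv_prodMap (p := (y, t)) h1 h2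
  rw [extChartAt_prod_posLine_symm, modelWithCornersSelf_prod, ← chartedSpaceSelf_prod, h]
  refine Prod.ext rfl ?_
  exact congrArg (fun L : ℝ →L[ℝ] ℝ ↦ L u.2) (mfderiv_extChartAt_posLine_symm σ ht)

theorem chartMetric_warpedMetric (g : FormField I M) (A B : ℝ → ℝ) (x : M) (σ : PosLine) {y : E}
    {t : ℝ} (hy : y ∈ (extChartAt I x).target) (ht : 0 < t) :
    chartMetric (warpedMetric g A B) (x, σ) (y, t) = warpField A B (chartMetric g x) (y, t) := by
  refine ContinuousLinearMap.ext fun u ↦ ContinuousLinearMap.ext fun v ↦ ?_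
  have hw (z z' : M × PosLine) (h : z = z') (a b a' b' : E × ℝ) (ha : a = a') (hb : b = b') :
      warpedMetric g A B z a b = warpForm (E := E) (A z'.2) (B z'.2) (g z'.1) a' b' := by
    subst h ha hb
    rfl
  rw [chartMetric_apply]
  refine (hw _ ((extChartAt I x).symm y, ⟨t, ht⟩) ?_ _ _ _ _
    (mfderiv_extChartAt_prod_posLine_symm x σ hy ht u)
    (mfderiv_extChartAt_prod_posLine_symm x σ hy ht v)).trans ?_
  · rw [extChartAt_prod_posLine_symm, Prod.map_apply, extChartAt_posLine_symm σ ht]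
  · exact (warpForm_apply (E := E) _ _ _ _ _).trans (warpForm_apply (E := E) _ _ _ _ _).symm

theorem mpullback_vertField (r : ℝ → ℝ) (x : M) (σ : PosLine) {y : E} {t : ℝ}
    (hy : y ∈ (extChartAt I x).target) (ht : 0 < t) :
    (VectorField.mpullback 𝓘(ℝ, E × ℝ) (I.prod 𝓘(ℝ, ℝ)) (extChartAt (I.prod 𝓘(ℝ, ℝ)) (x, σ)).symm
      (vertField r) (y, t) : E × ℝ) = (0, (deriv r t)⁻¹) := by
  have hi : (mfderiv 𝓘(ℝ, E × ℝ) (I.prod 𝓘(ℝ, ℝ))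
      (extChartAt (I.prod 𝓘(ℝ, ℝ)) (x, σ)).symm (y, t)).IsInvertible := by
    refine isInvertible_mfderiv_extChartAt_symm ?_
    rw [extChartAt_prod]
    exact ⟨hy, mem_extChartAt_posLine_target σ ht⟩
  have hv (z z' : M × PosLine) (h : z = z') :
      (vertField (I := I) r z : E × ℝ) = (0, (deriv r z'.2)⁻¹) := by
    subst h
    rfl
  refine inverse_apply_eq_of_isInvertible (F := E × ℝ) (F' := E × ℝ) hi ?_
  rw [hv _ ((extChartAt I x).symm y, ⟨t, ht⟩)]
  · refine (mfderiv_extChartAt_prod_posLine_symm x σ hy ht _).trans ?_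
    exact Prod.ext (ContinuousLinearMap.map_zero
      (mfderiv 𝓘(ℝ, E) I (extChartAt I x).symm y : E →L[ℝ] E)) rfl
  · rw [extChartAt_prod_posLine_symm, Prod.map_apply, extChartAt_posLine_symm σ ht]

end Product

/-! ### Curvature depends only on the germ of the metric. -/

section Germ

variable {E : Type*} [NormedAddCommGroup E] [NormedSpace ℝ E]

theorem eventually_flatChristoffel_congr {G G' : E → E →L[ℝ] E →L[ℝ] ℝ} {y : E}
    (h : G =ᶠ[𝓝 y] G') :
    ∀ᶠ z in 𝓝 y, ∀ u v, flatChristoffel G z u v = flatChristoffel G' z u v := by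
  filter_upwards [h.eventuallyEq_nhds] with z hz u v
  rw [flatChristoffel, flatChristoffel, flatChristoffelFirst, flatChristoffelFirst, hz.fderiv_eq,
    hz.eq_of_nhds]

theorem flatCurvature_congr {G G' : E → E →L[ℝ] E →L[ℝ] ℝ} {y : E} (h : G =ᶠ[𝓝 y] G')
    (u v w : E) : flatCurvature G y u v w = flatCurvature G' y u v w := by
  have he := eventually_flatChristoffel_congr h
  have hd (u v : E) : (fun z ↦ flatChristoffel G z u v) =ᶠ[𝓝 y]
      fun z ↦ flatChristoffel G' z u v := he.mono fun z hz ↦ hz u v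
  simp only [flatCurvature, (hd _ _).fderiv_eq, he.self_of_nhds]

end Germ

/-! ### One-variable calculus of the warping functions. -/

section Scalar

theorem eventually_hasDerivAt_and_pos {f : ℝ → ℝ} (hf : ContDiffOn ℝ ∞ f (Ioi 0))
    (hpos : ∀ t, 0 < t → 0 < f t) {s : ℝ} (hs : 0 < s) :
    ∀ᶠ t in 𝓝 s, HasDerivAt f (deriv f t) t ∧ 0 < f t := by
  filter_upwards [Ioi_mem_nhds hs] with t ht
  exact ⟨((hf.contDiffAt (Ioi_mem_nhds ht)).differentiableAt (by simp)).hasDerivAt, hpos t ht⟩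

theorem differentiableAt_deriv {f : ℝ → ℝ} (hf : ContDiffOn ℝ ∞ f (Ioi 0)) {s : ℝ} (hs : 0 < s) :
    DifferentiableAt ℝ (deriv f) s :=
  differentiableAt_apply_const (differentiableAt_fderiv
    ((hf.contDiffAt (Ioi_mem_nhds hs)).of_le (by norm_cast))) 1

/-- The second derivative of `√B` with respect to a coordinate `r` with `r' = √A`. -/
theorem coordDeriv_coordDeriv_sqrt {A B A' B' r : ℝ → ℝ} {s c : ℝ}
    (hA : ∀ᶠ t in 𝓝 s, HasDerivAt A (A' t) t ∧ 0 < A t)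
    (hB : ∀ᶠ t in 𝓝 s, HasDerivAt B (B' t) t ∧ 0 < B t)
    (hr : ∀ᶠ t in 𝓝 s, HasDerivAt r (√(A t)) t)
    (hc : HasDerivAt (fun t ↦ B' t / (2 * B t)) c s) :
    coordDeriv r (coordDeriv r (fun t ↦ √(B t))) s / √(B s) =
      (c + (B' s / (2 * B s)) ^ 2 - B' s / (2 * B s) * (A' s / (2 * A s))) / A s := by
  -- Factoring out `B'/(2B)` lets the product rule produce `c` directly.
  have h1 : coordDeriv r (fun t ↦ √(B t)) =ᶠ[𝓝 s]
      fun t ↦ B' t / (2 * B t) * (√(B t) / √(A t)) := by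
    filter_upwards [hA, hB, hr] with t hA hB hr
    rw [coordDeriv, hr.deriv, (hB.1.sqrt hB.2.ne').deriv]
    have ha := Real.sqrt_pos.2 hA.2
    have hb := Real.sqrt_pos.2 hB.2
    have hb' := Real.sq_sqrt hB.2.le
    generalize √(B t) = q at *
    -- With `B = q²` the identity becomes rational in `q`.
    rw [← hb']
    field_simp
  obtain ⟨hA1, hA2⟩ := hA.self_of_nhds
  obtain ⟨hB1, hB2⟩ := hB.self_of_nhds
  have ha := Real.sqrt_pos.2 hA2
  have hb := Real.sqrt_pos.2 hB2
  have h2 := hc.mul ((hB1.sqrt hB2.ne').div (hA1.sqrt hA2.ne') ha.ne')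
  rw [coordDeriv, hr.self_of_nhds.deriv, h1.deriv_eq]
  erw [h2.deriv]
  have ha' := Real.sq_sqrt hA2.le
  have hb' := Real.sq_sqrt hB2.le
  simp only [Pi.div_apply]
  generalize √(A s) = p at *
  generalize √(B s) = q at *
  rw [← ha', ← hb']
  field_simp
  ring

end Scalar

/-! ### Transfer from the manifold to the chart. -/

section Warped

variable {E : Type*} [NormedAddCommGroup E] [NormedSpace ℝ E]
  {H : Type*} [TopologicalSpace H] {I : ModelWithCorners ℝ E H} [I.Boundaryless]
  {M : Type*} [TopologicalSpace M] [ChartedSpace H M] [IsManifold I 1 M]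

omit [IsManifold I 1 M] in
theorem eventually_mem_chart (x : M) (σ : PosLine) :
    ∀ᶠ z in 𝓝 (extChartAt I x x, (σ : ℝ)), z.1 ∈ (extChartAt I x).target ∧ 0 < z.2 :=
  prod_mem_nhds (extChartAt_target_mem_nhds x) (Ioi_mem_nhds σ.2)

theorem chartMetric_warpedMetric_eventuallyEq (g : FormField I M) (A B : ℝ → ℝ) (x : M)
    (σ : PosLine) :
    chartMetric (warpedMetric g A B) (x, σ) =ᶠ[𝓝 (extChartAt I x x, (σ : ℝ))]
      warpField A B (chartMetric g x) := by
  filter_upwards [eventually_mem_chart x σ] with z hz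
  exact chartMetric_warpedMetric g A B x σ hz.1 hz.2

theorem curvature_warpedMetric (g : FormField I M) (A B : ℝ → ℝ) (x : M) (σ : PosLine)
    (u v w : E × ℝ) :
    (curvature (warpedMetric g A B) (x, σ) u v w : E × ℝ) =
      flatCurvature (warpField A B (chartMetric g x)) (extChartAt I x x, (σ : ℝ)) u v w :=
  flatCurvature_congr (chartMetric_warpedMetric_eventuallyEq g A B x σ) u v w

omit [I.Boundaryless] [IsManifold I 1 M] in
theorem sliceVector_eq (x : M) (σ : PosLine) (u : TangentSpace I x) :
    (sliceVector x σ u : E × ℝ) = ((u : E), (0 : ℝ)) :=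
  congrArg (fun L : E →L[ℝ] E × ℝ ↦ L u) (mfderiv_prod_left (I := I) (I' := 𝓘(ℝ, ℝ)) (y₀ := σ))

omit [I.Boundaryless] [IsManifold I 1 M] in
theorem secondFundamentalForm_eq (G : FormField (I.prod 𝓘(ℝ, ℝ)) (M × PosLine))
    (N : ∀ z : M × PosLine, TangentSpace (I.prod 𝓘(ℝ, ℝ)) z)
    (x : M) (σ : PosLine) (v : TangentSpace I x) :
    secondFundamentalForm G N x σ v = (covDeriv G N (x, σ) (sliceVector x σ v) : E × ℝ).1 :=
  congrArg (fun L : E × ℝ →L[ℝ] E ↦ L (covDeriv G N (x, σ) (sliceVector x σ v)))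
    (mfderiv_fst (I := I) (I' := 𝓘(ℝ, ℝ)))

/-- In the chart the field is `(0, 1 / r'(s))`, whose derivative along `(v, 0)` vanishes; only the
Christoffel term survives. -/
theorem covDeriv_warpedMetric_vertField (g : FormField I M) (A B r : ℝ → ℝ) (x : M) (σ : PosLine)
    (hr : DifferentiableAt ℝ (fun t ↦ (deriv r t)⁻¹) σ) (v : E) :
    (covDeriv (warpedMetric g A B) (vertField r) (x, σ) ((v, 0) : E × ℝ) : E × ℝ) =
      flatChristoffel (warpField A B (chartMetric g x)) (extChartAt I x x, (σ : ℝ)) (v, 0)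
        (0, (deriv r σ)⁻¹) := by
  have hX : (VectorField.mpullback 𝓘(ℝ, E × ℝ) (I.prod 𝓘(ℝ, ℝ))
      (extChartAt (I.prod 𝓘(ℝ, ℝ)) (x, σ)).symm (vertField r) : E × ℝ → E × ℝ)
      =ᶠ[𝓝 (extChartAt I x x, (σ : ℝ))] fun z ↦ ((0 : E), (deriv r z.2)⁻¹) := by
    filter_upwards [eventually_mem_chart x σ] with z hz
    exact mpullback_vertField r x σ hz.1 hz.2
  have hr' : HasFDerivAt (fun z : E × ℝ ↦ (deriv r z.2)⁻¹) _ (extChartAt I x x, (σ : ℝ)) :=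
    HasFDerivAt.comp (f := Prod.snd) (extChartAt I x x, (σ : ℝ)) hr.hasFDerivAt hasFDerivAt_snd
  have hd : HasFDerivAt (fun z : E × ℝ ↦ ((0 : E), (deriv r z.2)⁻¹)) _
      (extChartAt I x x, (σ : ℝ)) := (hasFDerivAt_const _ _).prodMk hr'
  have hΓ := (eventually_flatChristoffel_congr
    (chartMetric_warpedMetric_eventuallyEq g A B x σ)).self_of_nhds
  refine (congrArg₂ (fun a b : E × ℝ ↦ a + b) ?_ ?_).trans (zero_add _)
  · refine (congrArg (fun L : E × ℝ →L[ℝ] E × ℝ ↦ L (v, 0)) (hX.fderiv_eq.trans hd.fderiv)).trans ?_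
    simp
  · refine (hΓ _ _).trans ?_
    congr 1
    exact hX.eq_of_nhds

end Warped

/-! ### Nonvanishing of the Gram determinant. -/

section Form

variable {E : Type*} [NormedAddCommGroup E] [NormedSpace ℝ E]

/-- For `w = B(v,v) u - B(u,v) v`, the value `B(w,w)` is `B(v,v)` times the determinant. -/
theorem gram_det_pos {B : E →L[ℝ] E →L[ℝ] ℝ} (hs : ∀ u v, B u v = B v u)
    (hB : ∀ v ≠ 0, 0 < B v v) {u v : E} (h : LinearIndependent ℝ ![u, v]) :
    0 < B u u * B v v - B u v ^ 2 := by
  have hv : 0 < B v v := hB v (by simpa using h.ne_zero 1)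
  have hw : B v v • u - B u v • v ≠ 0 := by
    intro h0
    have := LinearIndependent.pair_iff.1 h (B v v) (-B u v) (by rw [← h0]; module)
    exact hv.ne' this.1
  have h1 := hB _ hw
  simp only [map_sub, map_smul, sub_apply, smul_apply, smul_eq_mul, hs v u] at h1
  refine pos_of_mul_pos_left (b := B v v) ?_ hv.le
  linarith

end Form

/-! ### Sectional curvature in coordinates. -/

section Sectional

variable {E : Type*} [NormedAddCommGroup E] [NormedSpace ℝ E]
  {H : Type*} [TopologicalSpace H] {I : ModelWithCorners ℝ E H}
  {M : Type*} [TopologicalSpace M] [ChartedSpace H M]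

theorem warpedMetric_apply (g : FormField I M) (A B : ℝ → ℝ) (x : M) (σ : PosLine)
    (u v : E × ℝ) :
    (warpedMetric g A B (x, σ) : (E × ℝ) →L[ℝ] (E × ℝ) →L[ℝ] ℝ) u v =
      A σ * (u.2 * v.2) + B σ * (g x : E →L[ℝ] E →L[ℝ] ℝ) u.1 v.1 :=
  warpForm_apply (E := E) _ _ _ _ _

/-- Since `U` is horizontal, pairing with it discards the vertical component of the curvature
vector. -/
theorem sectionalCurvature_warpedMetric [I.Boundaryless] [IsManifold I 1 M] (g : FormField I M)
    (b : E →L[ℝ] E →L[ℝ] ℝ) (A B : ℝ → ℝ) (x : M) (hb : g x = b) (σ : PosLine)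
    (U V : TangentSpace (I.prod 𝓘(ℝ, ℝ)) ((x, σ) : M × PosLine)) {u v : E} {c : ℝ}
    (hU : (U : E × ℝ) = (u, 0)) (hV : (V : E × ℝ) = (v, c)) :
    sectionalCurvature (warpedMetric g A B) (x, σ) U V =
      B σ * b (flatCurvature (warpField A B (chartMetric g x)) (extChartAt I x x, (σ : ℝ))
        (u, 0) (v, c) (v, c)).1 u /
      (B σ * b u u * (A σ * (c * c) + B σ * b v v) - (B σ * b u v) ^ 2) := by
  subst hU hV hb
  have h (b : E →L[ℝ] E →L[ℝ] ℝ) (R : E × ℝ) :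
      warpForm (A σ) (B σ) b R (u, 0) / (warpForm (A σ) (B σ) b (u, 0) (u, 0) *
        warpForm (A σ) (B σ) b (v, c) (v, c) - warpForm (A σ) (B σ) b (u, 0) (v, c) ^ 2) =
      B σ * b R.1 u / (B σ * b u u * (A σ * (c * c) + B σ * b v v) - (B σ * b u v) ^ 2) := by
    simp only [warpForm_apply, mul_zero, zero_mul, zero_add]
  refine Eq.trans ?_ (h _ _)
  rw [← curvature_warpedMetric]
  rfl

end Sectional

end WarpedMetrics

/-! ### The three curvature identities. -/

theorem proposition1
    {E : Type*} [NormedAddCommGroup E] [NormedSpace ℝ E] [FiniteDimensional ℝ E]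
    {H : Type*} [TopologicalSpace H] {I : ModelWithCorners ℝ E H} [I.Boundaryless]
    {M : Type*} [TopologicalSpace M] [ChartedSpace H M] [IsManifold I ∞ M]
    (g : ContMDiffRiemannianMetric I ∞ E (fun x : M ↦ TangentSpace I x))
    (I₀ I₁ r : ℝ → ℝ)
    (hI₀ : ContDiffOn ℝ ∞ I₀ (Set.Ioi 0)) (hI₁ : ContDiffOn ℝ ∞ I₁ (Set.Ioi 0))
    (hI₀_pos : ∀ σ, 0 < σ → 0 < I₀ σ) (hI₁_pos : ∀ σ, 0 < σ → 0 < I₁ σ)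
    (hr : ∀ σ, 0 < σ → HasDerivAt r (√(I₀ σ)) σ)
    (x : M) (σ : PosLine) :
    (∀ u v : TangentSpace I x, LinearIndependent ℝ ![u, v] →
      sectionalCurvature (warpedMetric g.inner I₀ I₁) (x, σ)
          (sliceVector x σ u) (sliceVector x σ v) =
        1 / I₁ σ * sectionalCurvature (I := I) g.inner x u v
          - 1 / 4 * (coordDeriv r I₁ σ / I₁ σ) ^ 2) ∧
    (∀ u : TangentSpace I x, u ≠ 0 →
      sectionalCurvature (warpedMetric g.inner I₀ I₁) (x, σ)
          (sliceVector x σ u) (vertField r (x, σ)) =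
        -(coordDeriv r (coordDeriv r (fun s ↦ √(I₁ s))) σ / √(I₁ σ))) ∧
    (warpedMetric (I := I) g.inner I₀ I₁ (x, σ) (vertField r (x, σ)) (vertField r (x, σ)) = 1 ∧
      (∀ v : TangentSpace I x,
        warpedMetric (I := I) g.inner I₀ I₁ (x, σ) (vertField r (x, σ)) (sliceVector x σ v) = 0) ∧
      ∀ v : TangentSpace I x,
        secondFundamentalForm (warpedMetric g.inner I₀ I₁) (vertField r) x σ v =
          (1 / 2 * (coordDeriv r I₁ σ / I₁ σ)) • v) := by
  have hσ : (0 : ℝ) < σ := σ.2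
  have hA := eventually_hasDerivAt_and_pos hI₀ hI₀_pos hσ
  have hB := eventually_hasDerivAt_and_pos hI₁ hI₁_pos hσ
  have hA' := differentiableAt_deriv hI₀ hσ
  have hB' := differentiableAt_deriv hI₁ hσ
  have hr_ev : ∀ᶠ t in 𝓝 (σ : ℝ), HasDerivAt r (√(I₀ t)) t := by
    filter_upwards [Ioi_mem_nhds hσ] with t ht using hr t ht
  have hrσ : deriv r σ = √(I₀ σ) := (hr σ hσ).deriv
  obtain ⟨hA1, hA2⟩ := hA.self_of_nhds
  obtain ⟨hB1, hB2⟩ := hB.self_of_nhds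
  have ha := Real.sqrt_pos.2 hA2
  have ha' := Real.sq_sqrt hA2.le
  have hG : ∀ᶠ z in 𝓝 (extChartAt I x x), DifferentiableAt ℝ (chartMetric g.inner x) z ∧
      ∀ v ≠ 0, 0 < chartMetric g.inner x z v v := by
    filter_upwards [extChartAt_target_mem_nhds x] with z hz
    exact ⟨(contDiffAt_chartMetric g hz).differentiableAt two_ne_zero, chartMetric_pos g hz⟩
  have hΓ (u v : E) : DifferentiableAt ℝ
      (fun z ↦ flatChristoffel (chartMetric g.inner x) z u v) (extChartAt I x x) :=
    differentiableAt_flatChristoffel (contDiffAt_chartMetric g (mem_extChartAt_target x))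
      (isInvertible_of_pos (chartMetric_pos g (mem_extChartAt_target x))) u v
  let b : E →L[ℝ] E →L[ℝ] ℝ := g.inner x
  have hb_symm : ∀ u v, b u v = b v u := g.symm x
  have hb_pos : ∀ v ≠ 0, 0 < b v v := g.pos x
  have hGb (u v : E) : chartMetric g.inner x (extChartAt I x x) u v = b u v :=
    chartMetric_self (I := I) g.inner x u v
  have hvert : (vertField (I := I) r (x, σ) : E × ℝ) = (0, (√(I₀ σ))⁻¹) :=
    congrArg (fun t : ℝ ↦ ((0 : E), t⁻¹)) hrσ
  have hslice (u : E) : (sliceVector (I := I) x σ u : E × ℝ) = (u, 0) := sliceVector_eq x σ u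
  -- The value left to unification is never unfolded: the same `c` occurs in the curvature and in
  -- the second derivative of `√I₁`, and matches there.
  have hc : HasDerivAt (fun t ↦ deriv I₁ t / (2 * I₁ t)) _ (σ : ℝ) :=
    hB'.hasDerivAt.div (hB1.const_mul 2) (by positivity)
  refine ⟨fun (u v : E) huv ↦ ?_, fun (u : E) hu ↦ ?_, ?_, fun (v : E) ↦ ?_, fun (v : E) ↦ ?_⟩
  · have hdet := (gram_det_pos hb_symm hb_pos huv).ne'
    refine (sectionalCurvature_warpedMetric (I := I) g.inner b I₀ I₁ x rfl σ _ _ (hslice u)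
      (hslice v)).trans ?_
    -- The curvature of `g` is by definition the flat curvature of its chart expression.
    change _ = 1 / I₁ σ * (b (flatCurvature (chartMetric g.inner x) (extChartAt I x x) u v v) u /
      (b u u * b v v - b u v ^ 2)) - 1 / 4 * (coordDeriv r I₁ σ / I₁ σ) ^ 2
    rw [fst_flatCurvature_warpField_horizontal hA hB hG hB' hΓ u v, hGb, hGb, coordDeriv, hrσ]
    simp only [map_sub, map_smul, sub_apply, smul_apply, smul_eq_mul, hb_symm v u]
    -- Both Gram determinants become multiples of the same `D`, which then cancels.
    have hden : I₁ σ * b u u * (I₀ σ * (0 * 0) + I₁ σ * b v v) - (I₁ σ * b u v) ^ 2 =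
        I₁ σ ^ 2 * (b u u * b v v - b u v ^ 2) := by ring
    have hnum : b v v * b u u - b u v * b u v = b u u * b v v - b u v ^ 2 := by ring
    rw [hden, hnum]
    generalize b u u * b v v - b u v ^ 2 = D at *
    generalize √(I₀ σ) = p at *
    rw [← ha']
    field_simp
  · have hu' := (hb_pos u hu).ne'
    refine (sectionalCurvature_warpedMetric (I := I) g.inner b I₀ I₁ x rfl σ _ _ (hslice u)
      hvert).trans ?_
    rw [fst_flatCurvature_warpField_mixed hA hB hG hA' hc,
      coordDeriv_coordDeriv_sqrt hA hB hr_ev hc]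
    have hone : I₀ σ * ((√(I₀ σ))⁻¹ * (√(I₀ σ))⁻¹) = 1 := by
      rw [← mul_inv, Real.mul_self_sqrt hA2.le, mul_inv_cancel₀ hA2.ne']
    simp only [map_smul, smul_apply, smul_eq_mul, map_zero, mul_zero, add_zero, hone, mul_one,
      ne_eq, OfNat.ofNat_ne_zero, not_false_eq_true, zero_pow, sub_zero]
    generalize √(I₀ σ) = p at *
    rw [← ha']
    field_simp
    ring
  · refine (congrArg (fun w : E × ℝ ↦ (warpedMetric (I := I) g.inner I₀ I₁ (x, σ) :
      (E × ℝ) →L[ℝ] (E × ℝ) →L[ℝ] ℝ) w w) hvert).trans ?_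
    refine (warpedMetric_apply (I := I) g.inner I₀ I₁ x σ _ _).trans ?_
    change I₀ σ * ((√(I₀ σ))⁻¹ * (√(I₀ σ))⁻¹) + I₁ σ * b 0 0 = 1
    rw [map_zero, mul_zero, add_zero]
    generalize √(I₀ σ) = p at *
    rw [← ha']
    field_simp
  · refine (congrArg₂ (fun w w' : E × ℝ ↦ (warpedMetric (I := I) g.inner I₀ I₁ (x, σ) :
      (E × ℝ) →L[ℝ] (E × ℝ) →L[ℝ] ℝ) w w') hvert (hslice v)).trans ?_
    refine (warpedMetric_apply (I := I) g.inner I₀ I₁ x σ _ _).trans ?_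
    change I₀ σ * ((√(I₀ σ))⁻¹ * 0) + I₁ σ * b 0 v = 0
    simp
  · have hri : DifferentiableAt ℝ (fun t ↦ (deriv r t)⁻¹) σ := by
      -- The regularity of `r'` is inherited from `√I₀`, with which it agrees near `σ`.
      have h : (fun t ↦ (deriv r t)⁻¹) =ᶠ[𝓝 (σ : ℝ)] fun t ↦ (√(I₀ t))⁻¹ :=
        hr_ev.mono fun t ht ↦ congrArg _ ht.deriv
      exact ((hA1.sqrt hA2.ne').inv ha.ne').differentiableAt.congr_of_eventuallyEq h
    have hcov : (covDeriv (warpedMetric g.inner I₀ I₁) (vertField r) (x, σ)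
        (sliceVector x σ v) : E × ℝ).1 = (1 / 2 * (coordDeriv r I₁ σ / I₁ σ)) • v := by
      refine (congrArg (fun w : E × ℝ ↦ (covDeriv (I := I.prod 𝓘(ℝ, ℝ))
        (warpedMetric g.inner I₀ I₁) (vertField r) (x, σ) w : E × ℝ).1) (hslice v)).trans ?_
      refine (congrArg Prod.fst
        (covDeriv_warpedMetric_vertField (I := I) g.inner I₀ I₁ r x σ hri v)).trans ?_
      rw [(eventually_flatChristoffel_warpField hA hB hG).self_of_nhds, hrσ, coordDeriv, hrσ]
      simp only [flatChristoffel_zero_right, zero_smul, zero_add, smul_smul]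
      congr 1
      field_simp
    exact (secondFundamentalForm_eq _ _ x σ v).trans hcov
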